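/- Let $K$ be a number field with algebraic closure $\overline{K}$, let $c\in K$ with $c\neq 0$, let $\mathcal{E}_2$ be the elliptic curve $y^2=x^3+c$, and let $K_7=K(\mathcal{E}_2[7])$ be the field generated over $K$ by the coordinates of the points of $\mathcal{E}_2(\overline{K})$ killed by $7$. Let $\zeta_3,\zeta_7\in\overline{K}$ be primitive third and seventh roots of unity and put $$\delta_1=-\big((-132\zeta_3-120)\zeta_7^5+(-168\zeta_3-12)\zeta_7^4+(-24\zeta_3+60)\zeta_7^3+(-60\zeta_3-84)\zeta_7^2+(-192\zeta_3-96)\zeta_7-96\zeta_3+52\big).$$ Let $\sqrt[3]{\delta_1c}$ and $\sqrt{(\delta_1+1)c}$ be any cube root of $\delta_1c$ and any square root of $(\delta_1+1)c$ in $\overline{K}$. Consider the conditions - **A**: $\zeta_3\notin K$; - **B1**: $\zeta_7+\zeta_7^{-1}\notin K(\zeta_3)$; - **B2**: $\zeta_7\notin K(\zeta_3,\zeta_7+\zeta_7^{-1})$; - **C**: $\sqrt[3]{\delta_1c}\notin K(\zeta_3,\zeta_7)$; - **D**: $\sqrt{(\delta_1+1)c}\notin K(\zeta_3,\zeta_7)$.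 Then $d=[K_7:K]$ is one of $72,36,24,18,12,9,8,6,4,3,2,1$, and each of these values occurs for some number field $K$ and some nonzero $c\in K$. Moreover $d$ is determined by the conditions as follows, where in each row exactly the listed conditions hold and the others fail ("one of" and "two of" mean exactly one and exactly two), and $d$ has the stated value if and only if the conditions that hold are as described in its row: - $d=72$: A, B1, B2, C, D; - $d=36$: B1, C and two of A, B2, D; - $d=24$: one of B1, C, and A, B2, D; - $d=18$: B1, C and one of A, B2, D; - $d=12$: one of B1, C and two of A, B2, D; - $d=9$: B1, C; - $d=8$: A, B2, D; - $d=6$: one of B1, C and one of A, B2, D; - $d=4$: two of A, B2, D; - $d=3$: one of B1, C; - $d=2$: one of A, B2, D; - $d=1$: no condition holds. -/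

import Mathlib

open IntermediateField

noncomputable section

/-- The curve `y² = x³ + c`. It is an elliptic curve (in characteristic `0`) exactly if `c ≠ 0`. -/
def mordellCurve {K : Type*} [Field K] (c : K) : WeierstrassCurve K where
  a₁ := 0
  a₂ := 0
  a₃ := 0
  a₄ := 0
  a₆ := c

open Classical in
/-- The `m`-th division field `K(E[m])` inside the algebraic closure of `K`: the field generated
over `K` by the coordinates of all (affine) points of `E` over the algebraic closure that are
killed by `m`. The point at infinity has no affine coordinates and contributes nothing. -/
def divisionField {K : Type*} [Field K] (E : WeierstrassCurve K) (m : ℕ) :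
    IntermediateField K (AlgebraicClosure K) :=
  adjoin K {z | ∃ (x y : AlgebraicClosure K)
    (h : (E.baseChange (AlgebraicClosure K)).toAffine.Nonsingular x y),
    m • WeierstrassCurve.Affine.Point.some x y h = 0 ∧ (z = x ∨ z = y)}

/-- The number `δ₁` attached to a primitive cube root of unity `ζ₃` and a primitive seventh root
of unity `ζ₇`. -/
def delta₁ {F : Type*} [CommRing F] (ζ₃ ζ₇ : F) : F :=
  -((-132 * ζ₃ - 120) * ζ₇ ^ 5 + (-168 * ζ₃ - 12) * ζ₇ ^ 4 + (-24 * ζ₃ + 60) * ζ₇ ^ 3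
    + (-60 * ζ₃ - 84) * ζ₇ ^ 2 + (-192 * ζ₃ - 96) * ζ₇ - 96 * ζ₃ + 52)

section Conditions

variable (K : Type*) [Field K] (ζ₃ ζ₇ : AlgebraicClosure K)

/-- Condition A: `ζ₃ ∉ K`. -/
def CondA : Prop := ζ₃ ∉ (⊥ : IntermediateField K (AlgebraicClosure K))

/-- Condition B1: `ζ₇ + ζ₇⁻¹ ∉ K(ζ₃)`. -/
def CondB1 : Prop := ζ₇ + ζ₇⁻¹ ∉ adjoin K {ζ₃}

/-- Condition B2: `ζ₇ ∉ K(ζ₃, ζ₇ + ζ₇⁻¹)`. -/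
def CondB2 : Prop := ζ₇ ∉ adjoin K {ζ₃, ζ₇ + ζ₇⁻¹}

/-- Condition C, for a cube root `r` of `δ₁ c`: `r ∉ K(ζ₃, ζ₇)`. -/
def CondC (r : AlgebraicClosure K) : Prop := r ∉ adjoin K {ζ₃, ζ₇}

/-- Condition D, for a square root `s` of `(δ₁ + 1) c`: `s ∉ K(ζ₃, ζ₇)`. -/
def CondD (s : AlgebraicClosure K) : Prop := s ∉ adjoin K {ζ₃, ζ₇}

end Conditions

/-- Exactly one of two conditions holds. -/
def OneOfTwo (P Q : Prop) : Prop := (P ∧ ¬Q) ∨ (¬P ∧ Q)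

/-- Exactly one of three conditions holds. -/
def OneOfThree (P Q R : Prop) : Prop := (P ∧ ¬Q ∧ ¬R) ∨ (¬P ∧ Q ∧ ¬R) ∨ (¬P ∧ ¬Q ∧ R)

/-- Exactly two of three conditions hold. -/
def TwoOfThree (P Q R : Prop) : Prop := (P ∧ Q ∧ ¬R) ∨ (P ∧ ¬Q ∧ R) ∨ (¬P ∧ Q ∧ R)

/-- None of three conditions holds. -/
def NoneOfThree (P Q R : Prop) : Prop := ¬P ∧ ¬Q ∧ ¬R

/-- The table of degrees: each row says which of the five conditions hold (the others failing)
precisely when the degree is `d`. -/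
def DegreeTable (A B1 B2 C D : Prop) (d : ℕ) : Prop :=
  (d = 72 ↔ A ∧ B1 ∧ B2 ∧ C ∧ D) ∧
  (d = 36 ↔ (B1 ∧ C) ∧ TwoOfThree A B2 D) ∧
  (d = 24 ↔ OneOfTwo B1 C ∧ A ∧ B2 ∧ D) ∧
  (d = 18 ↔ (B1 ∧ C) ∧ OneOfThree A B2 D) ∧
  (d = 12 ↔ OneOfTwo B1 C ∧ TwoOfThree A B2 D) ∧
  (d = 9 ↔ (B1 ∧ C) ∧ NoneOfThree A B2 D) ∧
  (d = 8 ↔ (¬B1 ∧ ¬C) ∧ A ∧ B2 ∧ D) ∧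
  (d = 6 ↔ OneOfTwo B1 C ∧ OneOfThree A B2 D) ∧
  (d = 4 ↔ (¬B1 ∧ ¬C) ∧ TwoOfThree A B2 D) ∧
  (d = 3 ↔ OneOfTwo B1 C ∧ NoneOfThree A B2 D) ∧
  (d = 2 ↔ (¬B1 ∧ ¬C) ∧ OneOfThree A B2 D) ∧
  (d = 1 ↔ (¬B1 ∧ ¬C) ∧ NoneOfThree A B2 D)

/-- The twelve degrees. -/
def possibleDegrees : Finset ℕ := {72, 36, 24, 18, 12, 9, 8, 6, 4, 3, 2, 1}

end

/-!
A point `P` on `y² = x³ + c` with `x(P)³ = T c` has `y(P)² = (T + 1) c`, and doubling multiplies its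
coordinates by rational functions of `T`. Hence `7P = 0`, that is `x(3P) = x(4P)`, is a polynomial
condition on `T`. This polynomial splits over `ℚ(ζ₃, ζ₇)`: its roots are the six conjugates of `δ₁`
over `ℚ(ζ₃)` and the two numbers `(12 ω + 8) / 7`, with `ω` a primitive cube root of unity, which
come from the two primes of norm `7` in `ℤ[ζ₃] = End E`. Any two roots `T`, `T'` differ by a cube of
`ℚ(ζ₃, ζ₇)`, while `T + 1` and `T' + 1` differ by a square, so `K₇` is generated by `ζ₃`, `ζ₇`, one
cube root of `δ₁ c` and one square root of `(δ₁ + 1) c`. Its degree is a product of steps of degrees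
`2`, `3`, `2`, `3`, `2`, each of which is trivial exactly if the corresponding condition fails.

To realise the degrees, let `M = ℚ(ζ₂₁)`, which is abelian of degree `12`, and let `K` be a subfield
of any given codegree. As `3` is neither a square nor a cube in `M`, multiplying `c` by suitable
powers of `3` makes each of the last two conditions hold or fail.
-/

section Doubling

variable {F : Type*} [Field F]

/-- The ratio `x(2P) / x(P)` for a point `P` on `y² = x³ + c` with `x(P)³ = T c`. At `T = -1`, where
`2P = 0`, it takes the junk value `0`. -/
def doublingRatioX (T : F) : F := (T - 8) / (2 ^ 2 * (T + 1))

/-- The ratio `y(2P) / y(P)` for a point `P` on `y² = x³ + c` with `x(P)³ = T c`. At `T = -1`, where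
`2P = 0`, it takes the junk value `0`. -/
def doublingRatioY (T : F) : F := (T ^ 2 + 20 * T - 8) / (2 ^ 3 * (T + 1) ^ 2)

/-- The polynomial whose roots are the values of `x(P)³ / c` at the points `P` of order `7` on
`y² = x³ + c`; evaluated at `x³ / c` it is the seventh division polynomial, up to a power of `c`. -/
def torsionPoly (T : F) : F :=
  (7 * T ^ 2 - 4 * T + 16) * (T ^ 6 + 564 * T ^ 5 - 5808 * T ^ 4 - 123136 * T ^ 3
    - 189696 * T ^ 2 - 49152 * T + 4096)

variable [NeZero (2 : F)] {T : F}

theorem one_sub_doublingRatioX (hT : T + 1 ≠ 0) :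
    1 - doublingRatioX T = 3 * (T + 4) / (2 ^ 2 * (T + 1)) := by
  unfold doublingRatioX
  field_simp
  ring

theorem one_sub_doublingRatioY (hT : T + 1 ≠ 0) :
    1 - doublingRatioY T = (7 * T ^ 2 - 4 * T + 16) / (2 ^ 3 * (T + 1) ^ 2) := by
  unfold doublingRatioY
  field_simp
  ring

theorem mul_doublingRatioX_cube_add_one (hT : T + 1 ≠ 0) :
    T * doublingRatioX T ^ 3 + 1 = (T + 1) * doublingRatioY T ^ 2 := by
  unfold doublingRatioX doublingRatioY
  field_simp
  ring

theorem doublingRatioX_eq_one_iff [NeZero (3 : F)] (hT : T + 1 ≠ 0) :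
    doublingRatioX T = 1 ↔ T = -4 := by
  rw [eq_comm, ← sub_eq_zero, one_sub_doublingRatioX hT]
  simp [hT, two_ne_zero, three_ne_zero, add_eq_zero_iff_eq_neg]

theorem doublingRatioY_eq_zero_iff (hT : T + 1 ≠ 0) :
    doublingRatioY T = 0 ↔ T ^ 2 + 20 * T - 8 = 0 := by
  simp [doublingRatioY, hT, two_ne_zero]

theorem torsionPoly_eq_mul (hT : T + 1 ≠ 0) (hv : doublingRatioY T ≠ 0) :
    torsionPoly T = 2 ^ 14 * (T + 1) ^ 7 * doublingRatioY T ^ 2 *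
      ((T + 1) * (1 - doublingRatioY T) ^ 2 - T * (1 - doublingRatioX T) ^ 2 *
        (1 + doublingRatioX T + doublingRatioX T * doublingRatioX (T * doublingRatioX T ^ 3))) := by
  rw [doublingRatioX.eq_def (T * _), mul_doublingRatioX_cube_add_one hT,
    one_sub_doublingRatioX hT, one_sub_doublingRatioY hT]
  have hN : T ^ 2 + 20 * T - 8 ≠ 0 := mt (doublingRatioY_eq_zero_iff hT).mpr hv
  unfold torsionPoly doublingRatioX doublingRatioY
  generalize hN' : T ^ 2 + 20 * T - 8 = N at *
  field_simp
  subst hN'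
  ring

theorem torsionPoly_ne_zero_of_doublingRatioY_eq_zero [NeZero (3 : F)] (hT : T + 1 ≠ 0)
    (hv : doublingRatioY T = 0) : torsionPoly T ≠ 0 := by
  have hN : T ^ 2 + 20 * T - 8 = 0 := (doublingRatioY_eq_zero_iff hT).mp hv
  have hΨ : torsionPoly T = 2 ^ 12 * 3 ^ 12 * (130 * T - 51) := by unfold torsionPoly; grind
  have hunit : (130 * T - 51) * (-130 * T - 2651) = 1 := by linear_combination -16900 * hN
  rw [hΨ]
  exact mul_ne_zero (mul_ne_zero (pow_ne_zero _ two_ne_zero) (pow_ne_zero _ three_ne_zero))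
    (left_ne_zero_of_mul_eq_one hunit)

theorem torsionPoly_zero_ne_zero : torsionPoly (0 : F) ≠ 0 := by
  rw [show torsionPoly (0 : F) = 2 ^ 16 by norm_num [torsionPoly]]
  exact pow_ne_zero _ two_ne_zero

omit [NeZero (2 : F)] in
theorem torsionPoly_neg_one_ne_zero [NeZero (3 : F)] : torsionPoly (-1 : F) ≠ 0 := by
  rw [show torsionPoly (-1 : F) = -3 ^ 12 by norm_num [torsionPoly]]
  exact neg_ne_zero.mpr (pow_ne_zero _ three_ne_zero)

theorem torsionPoly_neg_four_ne_zero [NeZero (3 : F)] : torsionPoly (-4 : F) ≠ 0 := by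
  rw [show torsionPoly (-4 : F) = 2 ^ 16 * 3 ^ 8 by norm_num [torsionPoly]]
  exact mul_ne_zero (pow_ne_zero _ two_ne_zero) (pow_ne_zero _ three_ne_zero)

end Doubling

section MordellCurve

open WeierstrassCurve.Affine

variable {F : Type*} [Field F] {c T x y : F}

theorem mordellCurve_equation_iff :
    (mordellCurve c).toAffine.Equation x y ↔ y ^ 2 = x ^ 3 + c := by
  simp [equation_iff, mordellCurve]

theorem mordellCurve_negY : (mordellCurve c).toAffine.negY x y = -y := by
  simp [negY, mordellCurve]

theorem mordellCurve_nonsingular_iff [NeZero (2 : F)] [NeZero (3 : F)] (hc : c ≠ 0) :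
    (mordellCurve c).toAffine.Nonsingular x y ↔ y ^ 2 = x ^ 3 + c := by
  rw [nonsingular_iff, mordellCurve_equation_iff, and_iff_left_iff_imp]
  intro h
  by_contra! hsing
  have hx : x = 0 := by simpa [mordellCurve, three_ne_zero] using hsing.1.symm
  have hy : y = 0 := by
    have : 2 * y = 0 := by linear_combination (by simpa [mordellCurve] using hsing.2 : y = -y)
    simpa [two_ne_zero] using this
  exact hc (by simpa [hx, hy] using h.symm)

theorem nsmul_ne_zero_of_coprime {A : Type*} [AddGroup A] {a : A} {m n : ℕ} (hmn : m.Coprime n)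
    (ha : a ≠ 0) (hm : m • a = 0) : n • a ≠ 0 := fun hn ↦ by
  have hdvd := Nat.dvd_gcd (addOrderOf_dvd_of_nsmul_eq_zero hm) (addOrderOf_dvd_of_nsmul_eq_zero hn)
  rw [hmn, Nat.dvd_one, AddMonoid.addOrderOf_eq_one_iff] at hdvd
  exact ha hdvd

variable [DecidableEq F] [NeZero (2 : F)]

omit [NeZero (2 : F)] in
theorem two_nsmul_some_zero {h : (mordellCurve c).toAffine.Nonsingular x 0} :
    2 • Point.some x 0 h = 0 := by
  rw [two_nsmul]
  exact Point.add_self_of_Y_eq (by rw [mordellCurve_negY, neg_zero])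

theorem two_nsmul_some {h : (mordellCurve c).toAffine.Nonsingular x y} (hc : c ≠ 0)
    (hx : x ^ 3 = T * c) (hy : y ^ 2 = (T + 1) * c) (hT : T + 1 ≠ 0) :
    ∃ h₂, 2 • Point.some x y h = Point.some (x * doublingRatioX T) (y * doublingRatioY T) h₂ := by
  have hy0 : y ≠ 0 := by rintro rfl; simp [hT, hc] at hy
  have hne : y ≠ (mordellCurve c).toAffine.negY x y := by
    rwa [mordellCurve_negY, ne_eq, eq_neg_iff_add_eq_zero, ← two_mul, mul_eq_zero,
      or_iff_right two_ne_zero]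
  have hslope : (mordellCurve c).toAffine.slope x x y y = 3 * x ^ 2 / (2 * y) := by
    rw [slope_of_Y_ne rfl hne, mordellCurve_negY]
    simp only [mordellCurve]
    ring
  have hX : (mordellCurve c).toAffine.addX x x (3 * x ^ 2 / (2 * y)) = x * doublingRatioX T := by
    simp only [addX, mordellCurve, doublingRatioX]
    field_simp
    linear_combination 9 * x * (T + 1) * hx - 9 * T * x * hy
  have hY : (mordellCurve c).toAffine.addY x x y (3 * x ^ 2 / (2 * y)) = y * doublingRatioY T := by
    rw [addY, negAddY, hX, mordellCurve_negY]
    simp only [doublingRatioX, doublingRatioY]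
    field_simp
    linear_combination -3 * (T + 1) * (T - 8 - 4 * (T + 1)) * hx
      - (8 * (T + 1) ^ 2 + T ^ 2 + 20 * T - 8) * hy
  have hadd := Point.add_self_of_Y_ne (h₁ := h) hne
  simp only [hslope, hX, hY] at hadd
  exact ⟨_, (two_nsmul _).trans hadd⟩

theorem three_nsmul_some {h : (mordellCurve c).toAffine.Nonsingular x y} (hc : c ≠ 0)
    (hx : x ^ 3 = T * c) (hy : y ^ 2 = (T + 1) * c) (hT : T + 1 ≠ 0) (hx0 : x ≠ 0)
    (hu : doublingRatioX T ≠ 1) :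
    ∃ x₃ y₃ h₃, 3 • Point.some x y h = Point.some x₃ y₃ h₃ ∧
      T * (1 - doublingRatioX T) ^ 2 * x₃ = x * ((T + 1) * (1 - doublingRatioY T) ^ 2
        - T * (1 - doublingRatioX T) ^ 2 * (1 + doublingRatioX T)) := by
  obtain ⟨h₂, hP₂⟩ := two_nsmul_some (h := h) hc hx hy hT
  have hne : x * doublingRatioX T ≠ x := by simpa [hx0] using hu
  rw [succ_nsmul, hP₂, Point.add_of_X_ne hne]
  refine ⟨_, _, _, rfl, ?_⟩
  rw [slope_of_X_ne hne]
  simp only [addX, mordellCurve]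
  generalize doublingRatioX T = u at *
  generalize doublingRatioY T = v at *
  field_simp [sub_ne_zero.mpr hne]
  linear_combination (1 - u) ^ 2 * (1 - v) ^ 2 * (T * hy - (T + 1) * hx)

theorem seven_nsmul_eq_zero_iff_of_ne {h : (mordellCurve c).toAffine.Nonsingular x y}
    (hc : c ≠ 0) (hx : x ^ 3 = T * c) (hy : y ^ 2 = (T + 1) * c) (hT : T + 1 ≠ 0) (hx0 : x ≠ 0)
    (hu : doublingRatioX T ≠ 1) (hv : doublingRatioY T ≠ 0) :
    7 • Point.some x y h = 0 ↔ torsionPoly T = 0 := by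
  have hT0 : T ≠ 0 := by rintro rfl; simp [hx0] at hx
  obtain ⟨h₂, hP₂⟩ := two_nsmul_some (h := h) hc hx hy hT
  obtain ⟨x₃, y₃, h₃, hP₃, hx₃⟩ := three_nsmul_some (h := h) hc hx hy hT hx0 hu
  have hx₂ : (x * doublingRatioX T) ^ 3 = T * doublingRatioX T ^ 3 * c := by rw [mul_pow, hx]; ring
  have hy₂ : (y * doublingRatioY T) ^ 2 = (T * doublingRatioX T ^ 3 + 1) * c := by
    rw [mul_doublingRatioX_cube_add_one hT, mul_pow, hy]; ring
  have hT₂ : T * doublingRatioX T ^ 3 + 1 ≠ 0 := by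
    rw [mul_doublingRatioX_cube_add_one hT]
    exact mul_ne_zero hT (pow_ne_zero 2 hv)
  obtain ⟨h₄, hP₄⟩ := two_nsmul_some (h := h₂) hc hx₂ hy₂ hT₂
  rw [← hP₂, ← mul_nsmul] at hP₄
  have hΨ := torsionPoly_eq_mul hT hv
  set u := doublingRatioX T
  set v := doublingRatioY T
  set x₄ := x * u * doublingRatioX (T * u ^ 3) with hx₄
  have hX : x₃ = x₄ ↔ 7 • Point.some x y h = 0 := by
    -- `3P = 4P` is impossible, so `x(3P) = x(4P)` means `3P = -4P`.
    rw [add_nsmul _ 3 4, add_eq_zero_iff_eq_neg, hP₃, hP₄,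
      Point.X_eq_iff (h₁ := h₃) (h₂ := h₄), or_iff_right]
    rw [← hP₃, ← hP₄, succ_nsmul _ 3, left_eq_add]
    exact Point.some_ne_zero h
  have hdiff : T * (1 - u) ^ 2 * (x₃ - x₄) = x * ((T + 1) * (1 - v) ^ 2
      - T * (1 - u) ^ 2 * (1 + u + u * doublingRatioX (T * u ^ 3))) := by
    linear_combination hx₃ - T * (1 - u) ^ 2 * hx₄
  calc 7 • Point.some x y h = 0 ↔ T * (1 - u) ^ 2 * (x₃ - x₄) = 0 := by
        simp [← hX, hT0, sub_eq_zero, hu.symm]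
    _ ↔ torsionPoly T = 0 := by
        simp [hdiff, hΨ, hT, hv, hx0, two_ne_zero]

theorem seven_nsmul_eq_zero_iff [NeZero (3 : F)] {h : (mordellCurve c).toAffine.Nonsingular x y}
    (hc : c ≠ 0) (hx : x ^ 3 = T * c) (hy : y ^ 2 = (T + 1) * c) :
    7 • Point.some x y h = 0 ↔ torsionPoly T = 0 := by
  have hP : Point.some x y h ≠ 0 := Point.some_ne_zero h
  by_cases hT : T + 1 = 0
  · obtain rfl : y = 0 := by simpa [hT] using hy
    rw [eq_neg_of_add_eq_zero_left hT]
    exact iff_of_false (nsmul_ne_zero_of_coprime (by norm_num) hP two_nsmul_some_zero)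
      torsionPoly_neg_one_ne_zero
  obtain ⟨h₂, hP₂⟩ := two_nsmul_some (h := h) hc hx hy hT
  by_cases hv : doublingRatioY T = 0
  · have hP₄ : 4 • Point.some x y h = 0 := by
      rw [mul_nsmul _ 2 2, hP₂]
      simp only [hv, mul_zero]
      exact two_nsmul_some_zero
    exact iff_of_false (nsmul_ne_zero_of_coprime (by norm_num) hP hP₄)
      (torsionPoly_ne_zero_of_doublingRatioY_eq_zero hT hv)
  by_cases hxu : x * doublingRatioX T = x
  · have hP₃ : 3 • Point.some x y h = 0 := by
      rcases (Point.X_eq_iff (h₁ := h₂) (h₂ := h)).mp hxu with heq | heq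
      · rw [heq, two_nsmul, add_eq_left] at hP₂
        exact absurd hP₂ hP
      · rw [succ_nsmul, hP₂, heq, neg_add_cancel]
    refine iff_of_false (nsmul_ne_zero_of_coprime (by norm_num) hP hP₃) ?_
    rcases eq_or_ne x 0 with rfl | hx0
    · obtain rfl : T = 0 := by simpa [hc] using hx.symm
      exact torsionPoly_zero_ne_zero
    · obtain rfl : T = -4 := (doublingRatioX_eq_one_iff hT).mp (by simpa [hx0] using hxu)
      exact torsionPoly_neg_four_ne_zero
  have hx0 : x ≠ 0 := by rintro rfl; simp at hxu
  exact seven_nsmul_eq_zero_iff_of_ne hc hx hy hT hx0 (by simpa [hx0] using hxu) hv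

end MordellCurve

section TorsionRoots

variable {F : Type*} [Field F] {w z T : F}

theorem primitiveRoot_three_relation (hw : IsPrimitiveRoot w 3) : w ^ 2 + w + 1 = 0 := by
  have := hw.geom_sum_eq_zero (by norm_num)
  simp only [Finset.sum_range_succ, Finset.sum_range_zero] at this
  linear_combination this

theorem primitiveRoot_seven_relation (hz : IsPrimitiveRoot z 7) :
    z ^ 6 + z ^ 5 + z ^ 4 + z ^ 3 + z ^ 2 + z + 1 = 0 := by
  have := hz.geom_sum_eq_zero (by norm_num)
  simp only [Finset.sum_range_succ, Finset.sum_range_zero] at this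
  linear_combination this

theorem three_ne_zero_of_primitiveRoot (hw : IsPrimitiveRoot w 3) : (3 : F) ≠ 0 :=
  mod_cast (hw.neZero' (n := 3)).ne

theorem seven_ne_zero_of_primitiveRoot (hz : IsPrimitiveRoot z 7) : (7 : F) ≠ 0 :=
  mod_cast (hz.neZero' (n := 7)).ne

/-- The value of `x(P)³ / c` at the points `P ≠ 0` of `y² = x³ + c` killed by one of the two primes
of norm `7` of `ℤ[w] = End E`, for `w` a primitive cube root of unity. -/
def cmRoot (w : F) : F := (12 * w + 8) / 7

/-- The parameters `T` and `T'` define the same radicals up to factors in `F`: for every `c`,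
a cube root of `T' c` and a square root of `(T' + 1) c` are obtained from those of `T c` and
`(T + 1) c` by multiplication with nonzero elements of `F`. -/
def RadicalEquiv (T T' : F) : Prop :=
  ∃ a b, a ≠ 0 ∧ b ≠ 0 ∧ T' = T * a ^ 3 ∧ T' + 1 = (T + 1) * b ^ 2

theorem RadicalEquiv.symm {T T' : F} : RadicalEquiv T T' → RadicalEquiv T' T := by
  rintro ⟨a, b, ha, hb, hT, hT₁⟩
  exact ⟨a⁻¹, b⁻¹, inv_ne_zero ha, inv_ne_zero hb, by rw [hT]; field_simp, by rw [hT₁]; field_simp⟩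

theorem RadicalEquiv.trans {T T' T'' : F} :
    RadicalEquiv T T' → RadicalEquiv T' T'' → RadicalEquiv T T'' := by
  rintro ⟨a, b, ha, hb, hT, hT₁⟩ ⟨a', b', ha', hb', hT', hT₁'⟩
  exact ⟨a * a', b * b', mul_ne_zero ha ha', mul_ne_zero hb hb', by rw [hT', hT]; ring,
    by rw [hT₁', hT₁]; ring⟩

theorem RadicalEquiv.exists_pow_three_eq_mul {T T' : F} (h : RadicalEquiv T T') :
    ∃ m, m ^ 3 = T * (T' ^ 2 * (T' + 1) ^ 3) := by
  obtain ⟨a, -, -, -, ha, -⟩ := h.symm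
  exact ⟨T' * (T' + 1) * a, by rw [ha]; ring⟩

theorem RadicalEquiv.exists_sq_eq_mul {T T' : F} (h : RadicalEquiv T T') :
    ∃ m, m ^ 2 = (T + 1) * (T' ^ 2 * (T' + 1) ^ 3) := by
  obtain ⟨-, b, -, -, -, hb⟩ := h.symm
  exact ⟨T' * (T' + 1) ^ 2 * b, by rw [hb]; ring⟩

theorem cmRoot_mul_cmRoot_sq (hw : IsPrimitiveRoot w 3) (h7 : (7 : F) ≠ 0) :
    cmRoot w * cmRoot (w ^ 2) = 2 ^ 4 / 7 := by
  have := primitiveRoot_three_relation hw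
  unfold cmRoot
  grind

theorem cmRoot_ne_zero [NeZero (2 : F)] (hw : IsPrimitiveRoot w 3) (h7 : (7 : F) ≠ 0) :
    cmRoot w ≠ 0 := by
  have h := cmRoot_mul_cmRoot_sq hw h7
  have : (2 ^ 4 / 7 : F) ≠ 0 := div_ne_zero (pow_ne_zero _ two_ne_zero) h7
  exact left_ne_zero_of_mul (h ▸ this)

theorem cmRoot_add_one_ne_zero (hw : IsPrimitiveRoot w 3) (h7 : (7 : F) ≠ 0) :
    cmRoot w + 1 ≠ 0 := by
  have h3 := three_ne_zero_of_primitiveRoot hw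
  have hnorm : (cmRoot w + 1) * (cmRoot (w ^ 2) + 1) = 3 ^ 3 / 7 := by
    have := primitiveRoot_three_relation hw
    unfold cmRoot
    grind
  exact left_ne_zero_of_mul (hnorm ▸ div_ne_zero (pow_ne_zero _ h3) h7)

theorem radicalEquiv_delta₁_cmRoot [NeZero (2 : F)] (hw : IsPrimitiveRoot w 3)
    (hz : IsPrimitiveRoot z 7) : RadicalEquiv (delta₁ w z) (cmRoot w) := by
  have h7 := seven_ne_zero_of_primitiveRoot hz
  have hcube : cmRoot w = delta₁ w z * (((-7 - 5 * z - z ^ 2 - 9 * z ^ 3 - z ^ 4 - 5 * z ^ 5)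
      + (-7 - 4 * z - 5 * z ^ 2 - 3 * z ^ 3 - 5 * z ^ 4 - 4 * z ^ 5) * w) / 7) ^ 3 := by
    have := primitiveRoot_three_relation hw
    have := primitiveRoot_seven_relation hz
    unfold delta₁ cmRoot
    grind
  have hsq : cmRoot w + 1 = (delta₁ w z + 1) * (((-1 - 4 * z + 4 * z ^ 2 - 6 * z ^ 3)
      + (2 - 6 * z + 6 * z ^ 2 - 2 * z ^ 3) * w) / 7) ^ 2 := by
    have := primitiveRoot_three_relation hw
    have := primitiveRoot_seven_relation hz
    unfold delta₁ cmRoot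
    grind
  refine ⟨_, _, fun h ↦ cmRoot_ne_zero hw h7 ?_, fun h ↦ cmRoot_add_one_ne_zero hw h7 ?_,
    hcube, hsq⟩
  · rw [hcube, h, zero_pow three_ne_zero, mul_zero]
  · rw [hsq, h, zero_pow two_ne_zero, mul_zero]

theorem delta₁_sq_left (hw : IsPrimitiveRoot w 3) (hz : IsPrimitiveRoot z 7) :
    delta₁ (w ^ 2) z = delta₁ w (z ^ 6) := by
  have := primitiveRoot_three_relation hw
  have := primitiveRoot_seven_relation hz
  unfold delta₁
  grind

theorem radicalEquiv_cmRoot_cmRoot_sq [NeZero (2 : F)] (hw : IsPrimitiveRoot w 3)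
    (hz : IsPrimitiveRoot z 7) : RadicalEquiv (cmRoot w) (cmRoot (w ^ 2)) := by
  have hw' := hw.pow_of_coprime 2 (by norm_num)
  have hz' := hz.pow_of_coprime 6 (by norm_num)
  have h := radicalEquiv_delta₁_cmRoot hw' hz
  rw [delta₁_sq_left hw hz] at h
  exact (radicalEquiv_delta₁_cmRoot hw hz').symm.trans h

theorem exists_pow_three_eq_delta₁_mul [NeZero (2 : F)] (hw : IsPrimitiveRoot w 3)
    (hz : IsPrimitiveRoot z 7) : ∃ m, m ^ 3 = delta₁ w z * (2 ^ 4 / 7) := by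
  have hδ := radicalEquiv_delta₁_cmRoot hw hz
  obtain ⟨a', -, -, -, ha', -⟩ := hδ.trans (radicalEquiv_cmRoot_cmRoot_sq hw hz)
  obtain ⟨a, -, -, -, ha, -⟩ := hδ
  refine ⟨delta₁ w z * a * a', ?_⟩
  rw [← cmRoot_mul_cmRoot_sq hw (seven_ne_zero_of_primitiveRoot hz), ha, ha']
  ring

theorem prod_three_sub_delta₁ (hw : IsPrimitiveRoot w 3) (hz : IsPrimitiveRoot z 7) (T : F) :
    (T - delta₁ w z) * (T - delta₁ w (z ^ 2)) * (T - delta₁ w (z ^ 4)) =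
      T ^ 3 + 282 * T ^ 2 + 3072 * T + 3520
        - (2 * w + 1) * (2 * (z + z ^ 2 + z ^ 4) + 1) * (66 * T ^ 2 + 672 * T + 768) := by
  have h3 := primitiveRoot_three_relation hw
  have h7 := primitiveRoot_seven_relation hz
  have hsum : delta₁ w z + delta₁ w (z ^ 2) + delta₁ w (z ^ 4) =
      66 * ((2 * w + 1) * (2 * (z + z ^ 2 + z ^ 4) + 1)) - 282 := by
    clear * - h3 h7; unfold delta₁; grind
  have hpairs : delta₁ w z * delta₁ w (z ^ 2) + delta₁ w (z ^ 2) * delta₁ w (z ^ 4)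
      + delta₁ w (z ^ 4) * delta₁ w z =
      3072 - 672 * ((2 * w + 1) * (2 * (z + z ^ 2 + z ^ 4) + 1)) := by
    clear * - h3 h7; unfold delta₁; grind
  have hprod : delta₁ w z * delta₁ w (z ^ 2) * delta₁ w (z ^ 4) =
      768 * ((2 * w + 1) * (2 * (z + z ^ 2 + z ^ 4) + 1)) - 3520 := by
    clear * - h3 h7; unfold delta₁; grind
  linear_combination -T ^ 2 * hsum + T * hpairs - hprod

theorem torsionPoly_eq_prod (hw : IsPrimitiveRoot w 3) (hz : IsPrimitiveRoot z 7) (T : F) :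
    torsionPoly T = 7 * ((T - cmRoot w) * (T - cmRoot (w ^ 2))) *
      ((T - delta₁ w z) * (T - delta₁ w (z ^ 2)) * (T - delta₁ w (z ^ 4)) *
        ((T - delta₁ w (z ^ 6)) * (T - delta₁ w (z ^ 5)) * (T - delta₁ w (z ^ 3)))) := by
  have h3 := primitiveRoot_three_relation hw
  have h7 := primitiveRoot_seven_relation hz
  have h7' := seven_ne_zero_of_primitiveRoot hz
  have hquad : 7 * ((T - cmRoot w) * (T - cmRoot (w ^ 2))) = 7 * T ^ 2 - 4 * T + 16 := by
    unfold cmRoot; grind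
  have hprod := prod_three_sub_delta₁ hw hz T
  -- `q = √-3 √-7`; replacing `z` by `z⁻¹` changes its sign.
  set q := (2 * w + 1) * (2 * (z + z ^ 2 + z ^ 4) + 1) with hq
  have hprod' : (T - delta₁ w (z ^ 6)) * (T - delta₁ w (z ^ 5)) * (T - delta₁ w (z ^ 3)) =
      T ^ 3 + 282 * T ^ 2 + 3072 * T + 3520 + q * (66 * T ^ 2 + 672 * T + 768) := by
    have h := prod_three_sub_delta₁ hw (hz.pow_of_coprime 6 (by norm_num)) T
    have hmod (k m : ℕ) (hkm : 6 * k % 7 = m) : (z ^ 6) ^ k = z ^ m := by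
      rw [← pow_mul, ← pow_mod_orderOf, ← hz.eq_orderOf, hkm]
    rw [hmod 2 5 rfl, hmod 4 3 rfl] at h
    rw [h, hq]
    linear_combination -(2 * w + 1) * (66 * T ^ 2 + 672 * T + 768) * 2 * h7
  have hqq : q ^ 2 = 21 := by
    have hw' : (2 * w + 1) ^ 2 = -3 := by linear_combination 4 * h3
    have hz' : (2 * (z + z ^ 2 + z ^ 4) + 1) ^ 2 = -7 := by
      linear_combination (4 * z ^ 2 - 4 * z + 8) * h7
    rw [hq, mul_pow, hw', hz']
    norm_num
  rw [hquad, hprod, hprod', torsionPoly]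
  linear_combination (7 * T ^ 2 - 4 * T + 16) * (66 * T ^ 2 + 672 * T + 768) ^ 2 * hqq

theorem torsionPoly_delta₁ (hw : IsPrimitiveRoot w 3) (hz : IsPrimitiveRoot z 7) :
    torsionPoly (delta₁ w z) = 0 := by
  simp [torsionPoly_eq_prod hw hz]

theorem delta₁_ne_zero [NeZero (2 : F)] (hw : IsPrimitiveRoot w 3) (hz : IsPrimitiveRoot z 7) :
    delta₁ w z ≠ 0 :=
  fun h ↦ torsionPoly_zero_ne_zero (h ▸ torsionPoly_delta₁ hw hz)

theorem delta₁_add_one_ne_zero (hw : IsPrimitiveRoot w 3) (hz : IsPrimitiveRoot z 7) :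
    delta₁ w z + 1 ≠ 0 := by
  have : NeZero (3 : F) := ⟨three_ne_zero_of_primitiveRoot hw⟩
  exact fun h ↦ torsionPoly_neg_one_ne_zero <|
    eq_neg_of_add_eq_zero_left h ▸ torsionPoly_delta₁ hw hz

theorem eq_cmRoot_or_eq_delta₁ (hw : IsPrimitiveRoot w 3) (hz : IsPrimitiveRoot z 7)
    (hT : torsionPoly T = 0) :
    (∃ ω, IsPrimitiveRoot ω 3 ∧ T = cmRoot ω) ∨ ∃ ζ, IsPrimitiveRoot ζ 7 ∧ T = delta₁ w ζ := by
  have hpow (k : ℕ) (hk : k.Coprime 7) (h : T = delta₁ w (z ^ k)) :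
      ∃ ζ, IsPrimitiveRoot ζ 7 ∧ T = delta₁ w ζ := ⟨_, hz.pow_of_coprime k hk, h⟩
  simp only [torsionPoly_eq_prod hw hz, mul_eq_zero, sub_eq_zero,
    seven_ne_zero_of_primitiveRoot hz, false_or] at hT
  rcases hT with (h | h) | ((h | h) | h) | (h | h) | h
  · exact .inl ⟨w, hw, h⟩
  · exact .inl ⟨_, hw.pow_of_coprime 2 (by norm_num), h⟩
  · exact .inr ⟨z, hz, h⟩
  · exact .inr (hpow 2 (by norm_num) h)
  · exact .inr (hpow 4 (by norm_num) h)
  · exact .inr (hpow 6 (by norm_num) h)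
  · exact .inr (hpow 5 (by norm_num) h)
  · exact .inr (hpow 3 (by norm_num) h)

theorem doublingRatioX_delta₁ [NeZero (2 : F)] (hw : IsPrimitiveRoot w 3)
    (hz : IsPrimitiveRoot z 7) :
    doublingRatioX (delta₁ w z) = (1 + z ^ 2 + z ^ 3 - z ^ 4 + 2 * z ^ 5)
      + (-z ^ 2 + 2 * z ^ 3 - 2 * z ^ 4 + z ^ 5) * w := by
  rw [doublingRatioX,
    div_eq_iff (mul_ne_zero (pow_ne_zero _ two_ne_zero) (delta₁_add_one_ne_zero hw hz))]
  have := primitiveRoot_three_relation hw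
  have := primitiveRoot_seven_relation hz
  unfold delta₁
  grind

/-- In terms of the values `u k = x(2P) / x(P)` at the points `P` of order `7` with parameter
`delta₁ w (z ^ k)`, the root of unity `z` is a linear combination over `ℤ[w, 1/3]`. -/
theorem mem_of_forall_delta₁_mem {σ : Type*} [NeZero (2 : F)] [SetLike σ F]
    [SubfieldClass σ F] {S : σ} (hw : IsPrimitiveRoot w 3) (hz : IsPrimitiveRoot z 7) (hwS : w ∈ S)
    (hS : ∀ ζ, IsPrimitiveRoot ζ 7 → delta₁ w ζ ∈ S) : z ∈ S := by
  let u (k : ℕ) : F := doublingRatioX (delta₁ w (z ^ k))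
  have hu (k : ℕ) (hk : k.Coprime 7) : u k ∈ S := by
    have h := hS _ (hz.pow_of_coprime k hk)
    exact div_mem (sub_mem h (ofNat_mem S 8))
      (mul_mem (pow_mem (ofNat_mem S 2) 2) (add_mem h (one_mem S)))
  have hu_eq (k : ℕ) (hk : k.Coprime 7) := doublingRatioX_delta₁ hw (hz.pow_of_coprime k hk)
  have hsum : 3 ^ 3 * z = (-4 - 2 * w) * u 1 + (-1 + 4 * w) * u 2 + (1 - w) * u 3
      + (2 + w) * u 4 + (-5 - 4 * w) * u 5 + (-2 + 2 * w) * u 6 := by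
    simp only [u, hu_eq 1 (by norm_num), hu_eq 2 (by norm_num), hu_eq 3 (by norm_num),
      hu_eq 4 (by norm_num), hu_eq 5 (by norm_num), hu_eq 6 (by norm_num)]
    have := primitiveRoot_three_relation hw
    have := primitiveRoot_seven_relation hz
    clear hu_eq hu hS
    grind
  have h27 : (3 ^ 3 : F) ≠ 0 := pow_ne_zero 3 (three_ne_zero_of_primitiveRoot hw)
  rw [mul_comm, ← eq_div_iff h27] at hsum
  rw [hsum]
  refine div_mem ?_ (pow_mem (ofNat_mem S 3) 3)
  refine add_mem (add_mem (add_mem (add_mem (add_mem ?_ ?_) ?_) ?_) ?_) ?_ <;>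
    refine mul_mem ?_ (hu _ (by norm_num)) <;>
    apply_rules [add_mem, sub_mem, mul_mem, neg_mem, one_mem, ofNat_mem S]

theorem radicalEquiv_of_torsionPoly_eq_zero [NeZero (2 : F)] (hw : IsPrimitiveRoot w 3)
    (hz : IsPrimitiveRoot z 7) (hT : torsionPoly T = 0) : RadicalEquiv (delta₁ w z) T := by
  have hcm := radicalEquiv_delta₁_cmRoot hw hz
  rcases eq_cmRoot_or_eq_delta₁ hw hz hT with ⟨ω, hω, rfl⟩ | ⟨ζ, hζ, rfl⟩
  · obtain ⟨i, hi, hi3, rfl⟩ := hw.isPrimitiveRoot_iff.mp hω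
    interval_cases i
    · simp at hi3
    · rwa [pow_one]
    · exact hcm.trans (radicalEquiv_cmRoot_cmRoot_sq hw hz)
  · exact hcm.trans (radicalEquiv_delta₁_cmRoot hw hζ).symm

theorem map_delta₁ {A B : Type*} [CommRing A] [CommRing B] (f : A →+* B) (a b : A) :
    f (delta₁ a b) = delta₁ (f a) (f b) := by
  simp only [delta₁, map_neg, map_add, map_sub, map_mul, map_pow, map_ofNat]

theorem map_cmRoot {E : Type*} [Field E] (f : F →+* E) (a : F) : f (cmRoot a) = cmRoot (f a) := by
  simp only [cmRoot, map_div₀, map_add, map_mul, map_ofNat]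

theorem delta₁_mem {R σ : Type*} [CommRing R] [SetLike σ R] [SubringClass σ R] {S : σ} {a b : R}
    (ha : a ∈ S) (hb : b ∈ S) : delta₁ a b ∈ S := by
  lift a to S using ha
  lift b to S using hb
  exact map_delta₁ (SubringClass.subtype S) a b ▸ SetLike.coe_mem _

theorem map_torsionPoly {E : Type*} [Field E] (f : F →+* E) (T : F) :
    f (torsionPoly T) = torsionPoly (f T) := by
  simp only [torsionPoly, map_add, map_sub, map_mul, map_pow, map_ofNat]

end TorsionRoots

section DivisionField

open WeierstrassCurve.Affine

variable {K : Type*} [Field K] {c : K}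

theorem baseChange_mordellCurve (L : Type*) [Field L] [Algebra K L] :
    (mordellCurve c).baseChange L = mordellCurve (algebraMap K L c) := by
  ext <;> simp [mordellCurve]

theorem mem_of_pow_eq_pow {F σ : Type*} [Field F] [SetLike σ F] [SubfieldClass σ F] {S : σ}
    {n : ℕ} [NeZero n] {ζ x y : F} (hζ : IsPrimitiveRoot ζ n) (hζS : ζ ∈ S) (hy : y ∈ S)
    (h : x ^ n = y ^ n) : x ∈ S := by
  rcases eq_or_ne y 0 with rfl | hy0
  · rw [zero_pow (NeZero.ne n)] at h
    rwa [eq_zero_of_pow_eq_zero h]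
  · have hroot : (x / y) ^ n = 1 := by rw [div_pow, h, div_self (pow_ne_zero n hy0)]
    obtain ⟨i, -, hi⟩ := hζ.eq_pow_of_pow_eq_one hroot
    rw [← div_mul_cancel₀ x hy0, ← hi]
    exact mul_mem (pow_mem hζS i) hy

variable (K) in
theorem neZero_two_of_algebra (L : Type*) [Field L] [Algebra K L] [NeZero (2 : K)] :
    NeZero (2 : L) :=
  NeZero.nat_of_injective (n := 2) (algebraMap K L).injective

variable [NeZero (2 : AlgebraicClosure K)] [NeZero (3 : AlgebraicClosure K)]

theorem divisionField_mordellCurve_seven (hc : c ≠ 0) :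
    divisionField (mordellCurve c) 7 = adjoin K {t | ∃ T x y : AlgebraicClosure K,
      torsionPoly T = 0 ∧ x ^ 3 = T * algebraMap K _ c ∧ y ^ 2 = (T + 1) * algebraMap K _ c ∧
        (t = x ∨ t = y)} := by
  classical
  have hc' : algebraMap K (AlgebraicClosure K) c ≠ 0 := by simpa using hc
  unfold divisionField
  rw [baseChange_mordellCurve]
  congr 1
  ext t
  constructor
  · rintro ⟨x, y, h, h7, ht⟩
    have hx : x ^ 3 = x ^ 3 / algebraMap K _ c * algebraMap K _ c := (div_mul_cancel₀ _ hc').symm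
    have hy : y ^ 2 = (x ^ 3 / algebraMap K _ c + 1) * algebraMap K _ c := by
      rw [mordellCurve_equation_iff.mp h.1, add_mul, ← hx, one_mul]
    exact ⟨_, x, y, (seven_nsmul_eq_zero_iff hc' hx hy).mp (by convert h7), hx, hy, ht⟩
  · rintro ⟨T, x, y, hT, hx, hy, ht⟩
    have h := (mordellCurve_nonsingular_iff (x := x) (y := y) hc').mpr (by rw [hx, hy]; ring)
    exact ⟨x, y, h, by convert (seven_nsmul_eq_zero_iff (h := h) hc' hx hy).mpr hT, ht⟩

theorem mem_divisionField_of_pow_three {T x : AlgebraicClosure K} (hc : c ≠ 0)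
    (hT : torsionPoly T = 0) (hx : x ^ 3 = T * algebraMap K _ c) :
    x ∈ divisionField (mordellCurve c) 7 := by
  obtain ⟨y, hy⟩ := IsAlgClosed.exists_pow_nat_eq ((T + 1) * algebraMap K _ c) zero_lt_two
  rw [divisionField_mordellCurve_seven hc]
  exact subset_adjoin K _ ⟨T, x, y, hT, hx, hy, .inl rfl⟩

theorem mem_divisionField_of_sq {T y : AlgebraicClosure K} (hc : c ≠ 0)
    (hT : torsionPoly T = 0) (hy : y ^ 2 = (T + 1) * algebraMap K _ c) :
    y ∈ divisionField (mordellCurve c) 7 := by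
  obtain ⟨x, hx⟩ := IsAlgClosed.exists_pow_nat_eq (T * algebraMap K _ c) zero_lt_three
  rw [divisionField_mordellCurve_seven hc]
  exact subset_adjoin K _ ⟨T, x, y, hT, hx, hy, .inr rfl⟩

theorem mem_divisionField_of_torsionPoly_eq_zero {T : AlgebraicClosure K} (hc : c ≠ 0)
    (hT : torsionPoly T = 0) : T ∈ divisionField (mordellCurve c) 7 := by
  have hc' : algebraMap K (AlgebraicClosure K) c ≠ 0 := by simpa using hc
  obtain ⟨x, hx⟩ := IsAlgClosed.exists_pow_nat_eq (T * algebraMap K _ c) zero_lt_three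
  rw [eq_div_of_mul_eq hc' hx.symm]
  exact div_mem (pow_mem (mem_divisionField_of_pow_three hc hT hx) 3)
    (IntermediateField.algebraMap_mem _ c)

theorem mem_of_torsionPoly_eq_zero {F σ : Type*} [Field F] [SetLike σ F] [SubfieldClass σ F]
    {S : σ} {w z T : F} (hw : IsPrimitiveRoot w 3) (hz : IsPrimitiveRoot z 7) (hwS : w ∈ S)
    (hzS : z ∈ S) (hT : torsionPoly T = 0) : T ∈ S := by
  rcases eq_cmRoot_or_eq_delta₁ hw hz hT with ⟨ω, hω, rfl⟩ | ⟨ζ, hζ, rfl⟩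
  · have hωS : ω ∈ S :=
      mem_of_pow_eq_pow hw hwS (one_mem S) (by rw [hω.pow_eq_one, one_pow])
    exact div_mem (add_mem (mul_mem (ofNat_mem S 12) hωS) (ofNat_mem S 8)) (ofNat_mem S 7)
  · have hζS : ζ ∈ S :=
      mem_of_pow_eq_pow hz hzS (one_mem S) (by rw [hζ.pow_eq_one, one_pow])
    exact delta₁_mem hwS hζS

omit [NeZero (3 : AlgebraicClosure K)] in
theorem mem_of_torsionPoly_eq_zero_of_pow_eq {S : IntermediateField K (AlgebraicClosure K)}
    {w z r s T x y : AlgebraicClosure K} (hw : IsPrimitiveRoot w 3) (hz : IsPrimitiveRoot z 7)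
    (hr : r ^ 3 = delta₁ w z * algebraMap K _ c)
    (hs : s ^ 2 = (delta₁ w z + 1) * algebraMap K _ c) (hwS : w ∈ S) (hzS : z ∈ S) (hrS : r ∈ S)
    (hsS : s ∈ S) (hT : torsionPoly T = 0) (hx : x ^ 3 = T * algebraMap K _ c)
    (hy : y ^ 2 = (T + 1) * algebraMap K _ c) : x ∈ S ∧ y ∈ S := by
  lift T to S using mem_of_torsionPoly_eq_zero hw hz hwS hzS hT
  lift w to S using hwS
  lift z to S using hzS
  have h2 : NeZero (2 : S) :=
    ⟨fun h ↦ two_ne_zero ((map_ofNat S.val 2).symm.trans (congrArg S.val h |>.trans (map_zero _)))⟩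
  have hTS : torsionPoly T = 0 := S.val.injective
    ((map_torsionPoly S.val.toRingHom T).trans (hT.trans (map_zero _).symm))
  obtain ⟨a, b, -, -, hTa, hTb⟩ := radicalEquiv_of_torsionPoly_eq_zero
    (IsPrimitiveRoot.coe_submonoidClass_iff.mp hw) (IsPrimitiveRoot.coe_submonoidClass_iff.mp hz)
    hTS
  have hδ : ((delta₁ w z : S) : AlgebraicClosure K) = delta₁ (w : AlgebraicClosure K) z :=
    map_delta₁ S.val.toRingHom w z
  replace hTa : (T : AlgebraicClosure K) = delta₁ (w : AlgebraicClosure K) z * a ^ 3 := by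
    simp [hTa, hδ]
  replace hTb : (T + 1 : AlgebraicClosure K) = (delta₁ (w : AlgebraicClosure K) z + 1) * b ^ 2 := by
    rw [← hδ]; exact_mod_cast hTb
  have hxa : x ^ 3 = (r * a) ^ 3 := by rw [hx, hTa, mul_pow, hr]; ring
  have hyb : y ^ 2 = (s * b) ^ 2 := by rw [hy, hTb, mul_pow, hs]; ring
  refine ⟨mem_of_pow_eq_pow hw w.2 (mul_mem hrS a.2) hxa, ?_⟩
  rcases sq_eq_sq_iff_eq_or_eq_neg.mp hyb with rfl | rfl
  · exact mul_mem hsS b.2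
  · exact neg_mem (mul_mem hsS b.2)

theorem divisionField_mordellCurve_seven_eq_adjoin {w z r s : AlgebraicClosure K} (hc : c ≠ 0)
    (hw : IsPrimitiveRoot w 3) (hz : IsPrimitiveRoot z 7)
    (hr : r ^ 3 = delta₁ w z * algebraMap K _ c)
    (hs : s ^ 2 = (delta₁ w z + 1) * algebraMap K _ c) :
    divisionField (mordellCurve c) 7 = adjoin K {w, z, r, s} := by
  apply le_antisymm
  · rw [divisionField_mordellCurve_seven hc, adjoin_le_iff]
    rintro t ⟨T, x, y, hT, hx, hy, ht⟩
    have h := mem_of_torsionPoly_eq_zero_of_pow_eq (S := adjoin K {w, z, r, s}) hw hz hr hs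
      (subset_adjoin K _ (by simp)) (subset_adjoin K _ (by simp)) (subset_adjoin K _ (by simp))
      (subset_adjoin K _ (by simp)) hT hx hy
    rcases ht with rfl | rfl
    exacts [h.1, h.2]
  · have hΨ := torsionPoly_delta₁ hw hz
    have hr0 : r ≠ 0 := by rintro rfl; simp [delta₁_ne_zero hw hz, hc] at hr
    have hrD := mem_divisionField_of_pow_three hc hΨ hr
    have hwrD := mem_divisionField_of_pow_three hc hΨ (x := w * r)
      (by rw [mul_pow, hw.pow_eq_one, one_mul, hr])
    have hwD : w ∈ divisionField (mordellCurve c) 7 :=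
      mul_div_cancel_right₀ w hr0 ▸ div_mem hwrD hrD
    have hzD : z ∈ divisionField (mordellCurve c) 7 := mem_of_forall_delta₁_mem hw hz hwD
      fun ζ hζ ↦ mem_divisionField_of_torsionPoly_eq_zero hc (torsionPoly_delta₁ hw hζ)
    rw [adjoin_le_iff]
    rintro t (rfl | rfl | rfl | rfl)
    exacts [hwD, hzD, hrD, mem_divisionField_of_sq hc hΨ hs]

end DivisionField

section Degrees

open Polynomial Module

open Classical in
/-- The degree of a step in a tower which multiplies the degree by `n` if `P` holds, and is trivial
otherwise. -/
noncomputable def stepDegree (P : Prop) (n : ℕ) : ℕ := if P then n else 1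

theorem stepDegree_congr {P Q : Prop} (h : P ↔ Q) (n : ℕ) : stepDegree P n = stepDegree Q n := by
  rw [h]

theorem stepDegree_dvd (P : Prop) (n : ℕ) : stepDegree P n ∣ n := by
  unfold stepDegree
  split_ifs <;> simp

variable {K Ω : Type*} [Field K] [Field Ω] [Algebra K Ω] {S : Set Ω} {a : Ω}

theorem finrank_adjoin_insert {f : (adjoin K S)[X]} (hf : f.Monic)
    (hdeg : f.natDegree ∈ Finset.Icc 1 3) (ha : aeval a f = 0)
    (hroot : ∀ b ∈ adjoin K S, aeval b f = 0 → a ∈ adjoin K S) :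
    finrank K (adjoin K (insert a S)) =
      finrank K (adjoin K S) * stepDegree (a ∉ adjoin K S) f.natDegree := by
  have htower : finrank K (adjoin K (insert a S)) =
      finrank K (adjoin K S) * finrank (adjoin K S) (adjoin K S)⟮a⟯ := by
    rw [finrank_mul_finrank, ← Set.union_singleton, ← adjoin_adjoin_left]
    rfl
  rw [htower, adjoin.finrank ⟨f, hf, by simpa [aeval_def] using ha⟩, stepDegree]
  congr 1
  split_ifs with h
  · rw [minpoly.natDegree_eq_one_iff]
    exact ⟨⟨a, h⟩, rfl⟩
  · have hirr : Irreducible f := irreducible_of_degree_le_three_of_not_isRoot hdeg fun b hb ↦ h <|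
      hroot b b.2 <| (aeval_algebraMap_apply_eq_algebraMap_eval b f).trans
        (by rw [hb.eq_zero, map_zero])
    rw [← minpoly.eq_of_irreducible_of_monic hirr ha hf]

theorem finrank_adjoin_insert_of_sq_eq {p q : Ω} (hp : p ∈ adjoin K S) (hq : q ∈ adjoin K S)
    (ha : a ^ 2 = p * a + q) :
    finrank K (adjoin K (insert a S)) =
      finrank K (adjoin K S) * stepDegree (a ∉ adjoin K S) 2 := by
  let f : (adjoin K S)[X] := X ^ 2 - (C ⟨p, hp⟩ * X + C ⟨q, hq⟩)
  have haeval (b : Ω) : aeval b f = b ^ 2 - (p * b + q) := by simp [f]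
  have hdeg : f.natDegree = 2 := by unfold f; compute_degree!
  rw [← hdeg]
  refine finrank_adjoin_insert (by unfold f; monicity!) (by simp [hdeg])
    (by rw [haeval, ha, sub_self]) fun b hb hb0 ↦ ?_
  rw [haeval] at hb0
  have : (a - b) * (a - (p - b)) = 0 := by linear_combination ha - hb0
  rcases mul_eq_zero.mp this with h | h <;> rw [sub_eq_zero.mp h]
  exacts [hb, sub_mem hp hb]

theorem finrank_adjoin_insert_of_pow_mem {n : ℕ} (hn : n ∈ Finset.Icc 1 3) {ζ : Ω}
    (hζ : IsPrimitiveRoot ζ n) (hζS : ζ ∈ adjoin K S) (ha : a ^ n ∈ adjoin K S) :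
    finrank K (adjoin K (insert a S)) =
      finrank K (adjoin K S) * stepDegree (a ∉ adjoin K S) n := by
  have hn0 : NeZero n := ⟨by rintro rfl; simp at hn⟩
  let f : (adjoin K S)[X] := X ^ n - C ⟨a ^ n, ha⟩
  have haeval (b : Ω) : aeval b f = b ^ n - a ^ n := by simp [f]
  have hdeg : f.natDegree = n := natDegree_X_pow_sub_C
  rw [← hdeg]
  refine finrank_adjoin_insert (monic_X_pow_sub_C _ (NeZero.ne n)) (hdeg.symm ▸ hn)
    (by rw [haeval, sub_self]) fun b hb hb0 ↦ ?_
  rw [haeval, sub_eq_zero] at hb0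
  exact mem_of_pow_eq_pow hζ hζS hb hb0.symm

/-- The polynomial `X³ + X² - 2X - 1` of the sums `ζ + ζ⁻¹` of primitive seventh roots of unity is
cyclic: its roots are the iterates of any of them under `b ↦ b² - 2`. -/
theorem finrank_adjoin_insert_of_cubic (ha : a ^ 3 + a ^ 2 - 2 * a - 1 = 0) :
    finrank K (adjoin K (insert a S)) =
      finrank K (adjoin K S) * stepDegree (a ∉ adjoin K S) 3 := by
  let f : (adjoin K S)[X] := X ^ 3 + X ^ 2 - C 2 * X - C 1
  have haeval (b : Ω) : aeval b f = b ^ 3 + b ^ 2 - 2 * b - 1 := by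
    simp only [f, map_add, map_sub, map_mul, map_pow, aeval_X, map_ofNat, map_one]
  have hdeg : f.natDegree = 3 := by unfold f; compute_degree!
  rw [← hdeg]
  refine finrank_adjoin_insert (by unfold f; monicity!) (by simp [hdeg])
    (by rw [haeval, ha]) fun b hb hb0 ↦ ?_
  rw [haeval] at hb0
  have hroots : (a - b) * ((a - (b ^ 2 - 2)) * (a - (1 - b - b ^ 2))) = 0 := by
    linear_combination ha + (b ^ 2 - a * b - 1) * hb0
  have hsq : b ^ 2 - 2 ∈ adjoin K S := sub_mem (pow_mem hb 2) (ofNat_mem _ 2)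
  simp only [mul_eq_zero, sub_eq_zero] at hroots
  rcases hroots with rfl | rfl | rfl
  exacts [hb, hsq, sub_mem (sub_mem (one_mem _) hb) (pow_mem hb 2)]

end Degrees

section ConditionDegrees

open Module

variable {K : Type*} [Field K] {w z r s : AlgebraicClosure K}

theorem finrank_adjoin_primitiveRoots (hw : IsPrimitiveRoot w 3) (hz : IsPrimitiveRoot z 7) :
    finrank K (adjoin K {w, z}) =
      stepDegree (CondA K w) 2 * stepDegree (CondB1 K w z) 3 * stepDegree (CondB2 K w z) 2 := by
  set η := z + z⁻¹ with hη
  have hz0 : z ≠ 0 := hz.ne_zero (by norm_num)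
  have hcubic : η ^ 3 + η ^ 2 - 2 * η - 1 = 0 := by
    rw [hη]
    field_simp
    linear_combination primitiveRoot_seven_relation hz
  have hA := finrank_adjoin_insert_of_sq_eq (K := K) (S := ∅) (a := w) (p := -1) (q := -1)
    (neg_mem (one_mem _)) (neg_mem (one_mem _))
    (by linear_combination primitiveRoot_three_relation hw)
  have hB1 := finrank_adjoin_insert_of_cubic (K := K) (S := {w}) hcubic
  have hB2 := finrank_adjoin_insert_of_sq_eq (K := K) (S := {w, η}) (a := z) (p := η) (q := -1)
    (subset_adjoin K _ (by simp)) (neg_mem (one_mem _)) (by rw [hη]; field_simp; ring)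
  have hset : adjoin K (insert z {w, η}) = adjoin K {w, z} := by
    have hzm : z ∈ adjoin K {w, z} := subset_adjoin K _ (by simp)
    apply le_antisymm
    · rw [adjoin_le_iff]
      rintro t (rfl | rfl | rfl)
      exacts [hzm, subset_adjoin K _ (by simp), add_mem hzm (inv_mem hzm)]
    · exact adjoin.mono K _ _ (by grind)
  rw [insert_empty_eq, adjoin_empty, IntermediateField.finrank_bot, one_mul] at hA
  rw [← hset, hB2, Set.pair_comm w η, hB1, hA, Set.pair_comm η w]
  rfl

theorem finrank_adjoin_radicals (hw : IsPrimitiveRoot w 3) (hr : r ^ 3 ∈ adjoin K {w, z})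
    (hs : s ^ 2 ∈ adjoin K {w, z}) :
    finrank K (adjoin K {w, z, r, s}) =
      finrank K (adjoin K {w, z}) * stepDegree (CondC K w z r) 3 *
        stepDegree (CondD K w z s) 2 := by
  have hle (t) : adjoin K {w, z} ≤ adjoin K (insert t {w, z}) :=
    adjoin.mono K _ _ (Set.subset_insert _ _)
  have hC := finrank_adjoin_insert_of_pow_mem (by simp) hw (subset_adjoin K _ (by simp)) hr
  have hD := finrank_adjoin_insert_of_sq_eq (zero_mem _) (hle r hs) (by ring)
  have hD' := finrank_adjoin_insert_of_sq_eq (zero_mem _) hs (by ring)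
  have hfin : FiniteDimensional K (adjoin K {w, z}) :=
    finiteDimensional_adjoin fun x _ ↦ Algebra.IsIntegral.isIntegral x
  -- The step at `r` has odd degree, so it does not affect whether `s` is adjoined.
  have hiff : s ∉ adjoin K (insert r {w, z}) ↔ s ∉ adjoin K {w, z} := by
    refine not_congr ⟨fun h ↦ ?_, fun h ↦ hle r h⟩
    by_contra hcon
    have hsub : adjoin K (insert s {w, z}) ≤ adjoin K (insert r {w, z}) :=
      adjoin_le_iff.mpr (Set.insert_subset h fun t ht ↦ hle r (subset_adjoin K _ ht))
    have hdvd := finrank_dvd_of_le_right hsub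
    rw [hD', hC] at hdvd
    have h23 := (Nat.dvd_of_mul_dvd_mul_left finrank_pos hdvd).trans (stepDegree_dvd _ 3)
    norm_num [stepDegree, hcon] at h23
  have hset : ({w, z, r, s} : Set (AlgebraicClosure K)) = insert s (insert r {w, z}) := by grind
  rw [hset, hD, hC, stepDegree_congr hiff]
  rfl

theorem degreeTable_stepDegree (A B1 B2 C D : Prop) {d : ℕ} (hd : d = stepDegree A 2 *
      stepDegree B1 3 * stepDegree B2 2 * stepDegree C 3 * stepDegree D 2) :
    d ∈ possibleDegrees ∧ DegreeTable A B1 B2 C D d := by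
  subst hd
  unfold DegreeTable OneOfTwo OneOfThree TwoOfThree NoneOfThree possibleDegrees stepDegree
  by_cases A <;> by_cases B1 <;> by_cases B2 <;> by_cases C <;> by_cases D <;> simp [*]

theorem finrank_divisionField_mordellCurve_seven [NeZero (2 : K)] {c : K} (hc : c ≠ 0)
    (hw : IsPrimitiveRoot w 3) (hz : IsPrimitiveRoot z 7)
    (hr : r ^ 3 = delta₁ w z * algebraMap K _ c)
    (hs : s ^ 2 = (delta₁ w z + 1) * algebraMap K _ c) :
    finrank K (divisionField (mordellCurve c) 7) =
      finrank K (adjoin K {w, z}) * stepDegree (CondC K w z r) 3 *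
        stepDegree (CondD K w z s) 2 := by
  have h2 := neZero_two_of_algebra K (AlgebraicClosure K)
  have h3 : NeZero (3 : AlgebraicClosure K) := ⟨three_ne_zero_of_primitiveRoot hw⟩
  have hδ : delta₁ w z ∈ adjoin K {w, z} :=
    delta₁_mem (subset_adjoin K _ (by simp)) (subset_adjoin K _ (by simp))
  have hcm := (adjoin K {w, z}).algebraMap_mem c
  rw [divisionField_mordellCurve_seven_eq_adjoin hc hw hz hr hs]
  exact finrank_adjoin_radicals hw (hr ▸ mul_mem hδ hcm)
    (hs ▸ mul_mem (add_mem hδ (one_mem _)) hcm)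

end ConditionDegrees

section Twists

open Module

theorem exists_pow_eq_mul_pow_iff {F : Type*} [Field F] {n : ℕ} {a b : F} (hb : b ≠ 0) :
    (∃ m, m ^ n = a * b ^ n) ↔ ∃ m, m ^ n = a := by
  constructor
  · rintro ⟨m, hm⟩
    exact ⟨m / b, by rw [div_pow, hm, mul_div_cancel_right₀ _ (pow_ne_zero n hb)]⟩
  · rintro ⟨m, rfl⟩
    exact ⟨m * b, mul_pow m b n⟩

variable {K M : Type*} [Field K] [Field M] [Algebra K M]

theorem exists_twist {n k : ℕ} [NeZero n] (hk : k.Coprime n) {e : M} (he : e ≠ 0) (e' : M)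
    {c t : K} (hc : c ≠ 0) (ht : ∀ m : M, m ^ n ≠ algebraMap K M t) :
    ∃ c' : K, c' ≠ 0 ∧ (¬∃ m, m ^ n = e * algebraMap K M c') ∧
      ((∃ m, m ^ k = e' * algebraMap K M c') ↔ ∃ m, m ^ k = e' * algebraMap K M c) := by
  have ht0 : t ≠ 0 := by rintro rfl; exact ht 0 (by simp [NeZero.ne n])
  have hcM : algebraMap K M c ≠ 0 := by simpa
  obtain ⟨b, hb, hbn⟩ : ∃ b : K, b ≠ 0 ∧ ¬∃ m, m ^ n = e * algebraMap K M (c * b ^ k) := by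
    by_contra! h
    obtain ⟨m₀, h₀⟩ := h 1 one_ne_zero
    obtain ⟨m₁, h₁⟩ := h t ht0
    rw [one_pow, mul_one] at h₀
    have hpow : (m₁ / m₀) ^ n = algebraMap K M t ^ k := by
      rw [div_pow, h₀, h₁, map_mul, map_pow, ← mul_assoc,
        mul_div_cancel_left₀ _ (mul_ne_zero he hcM)]
    obtain ⟨m, hm⟩ := (pow_mem_range_pow_of_coprime hk (algebraMap K M t)).mp ⟨_, hpow⟩
    exact ht m hm
  refine ⟨c * b ^ k, mul_ne_zero hc (pow_ne_zero k hb), hbn, ?_⟩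
  rw [map_mul, map_pow, ← mul_assoc, exists_pow_eq_mul_pow_iff (by simpa)]

theorem mem_fieldRange_iff_exists_pow_eq {E : Type*} [Field E] [Algebra K E] {n : ℕ} [NeZero n]
    (φ : M →ₐ[K] E) {ω : M} (hω : IsPrimitiveRoot ω n) {e : M} {t : E} (ht : t ^ n = φ e) :
    t ∈ φ.fieldRange ↔ ∃ m, m ^ n = e := by
  constructor
  · rintro ⟨m, rfl⟩
    exact ⟨m, φ.injective ((map_pow φ m n).trans ht)⟩
  · rintro ⟨m, rfl⟩
    exact mem_of_pow_eq_pow (hω.map_of_injective φ.injective) ⟨ω, rfl⟩ ⟨m, rfl⟩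
      (ht.trans (map_pow φ m n))

variable [NeZero (2 : K)] {w z : M}

theorem exists_pow_three_eq_and_sq_eq_of_mem_range (hw : IsPrimitiveRoot w 3)
    (hz : IsPrimitiveRoot z 7) (hwK : w ∈ Set.range (algebraMap K M)) :
    ∃ c : K, c ≠ 0 ∧ (∃ m, m ^ 3 = delta₁ w z * algebraMap K M c) ∧
      ∃ m, m ^ 2 = (delta₁ w z + 1) * algebraMap K M c := by
  obtain ⟨ω, rfl⟩ := hwK
  have h2 := neZero_two_of_algebra K M
  have h7 := seven_ne_zero_of_primitiveRoot hz
  have hδ := radicalEquiv_delta₁_cmRoot hw hz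
  have hmap : algebraMap K M (cmRoot ω ^ 2 * (cmRoot ω + 1) ^ 3) =
      cmRoot (algebraMap K M ω) ^ 2 * (cmRoot (algebraMap K M ω) + 1) ^ 3 := by
    rw [← map_cmRoot]
    simp only [map_mul, map_pow, map_add, map_one]
  refine ⟨cmRoot ω ^ 2 * (cmRoot ω + 1) ^ 3, ?_, ?_, ?_⟩
  · rw [← map_ne_zero (algebraMap K M), hmap]
    exact mul_ne_zero (pow_ne_zero 2 (cmRoot_ne_zero hw h7))
      (pow_ne_zero 3 (cmRoot_add_one_ne_zero hw h7))
  · exact hmap ▸ hδ.exists_pow_three_eq_mul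
  · exact hmap ▸ hδ.exists_sq_eq_mul

variable [Algebra.IsAlgebraic K M]

theorem finrank_divisionField_mordellCurve_seven_of_adjoin_eq_top (hw : IsPrimitiveRoot w 3)
    (hz : IsPrimitiveRoot z 7) (htop : adjoin K {w, z} = ⊤) {c : K} (hc : c ≠ 0) :
    finrank K (divisionField (mordellCurve c) 7) = finrank K M *
      stepDegree (¬∃ m, m ^ 3 = delta₁ w z * algebraMap K M c) 3 *
      stepDegree (¬∃ m, m ^ 2 = (delta₁ w z + 1) * algebraMap K M c) 2 := by
  let φ : M →ₐ[K] AlgebraicClosure K := IsAlgClosed.lift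
  have hφw := hw.map_of_injective φ.injective
  have hrange : adjoin K {φ w, φ z} = φ.fieldRange := by
    rw [AlgHom.fieldRange_eq_map, ← htop, adjoin_map, Set.image_pair]
  have hfin : finrank K (adjoin K {φ w, φ z}) = finrank K M :=
    hrange ▸ (AlgEquiv.ofInjectiveField φ).toLinearEquiv.finrank_eq.symm
  have hδ : φ (delta₁ w z) = delta₁ (φ w) (φ z) := map_delta₁ φ.toRingHom w z
  obtain ⟨r, hr⟩ := IsAlgClosed.exists_pow_nat_eq (φ (delta₁ w z * algebraMap K M c)) zero_lt_three
  obtain ⟨s, hs⟩ := IsAlgClosed.exists_pow_nat_eq (φ ((delta₁ w z + 1) * algebraMap K M c))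
    zero_lt_two
  have h2 := neZero_two_of_algebra K M
  have hneg : IsPrimitiveRoot (-1 : M) 2 := by
    have hne : (-1 : M) ≠ 1 := fun h ↦ two_ne_zero (α := M) (by linear_combination -h)
    exact orderOf_eq_prime neg_one_sq hne ▸ IsPrimitiveRoot.orderOf (-1)
  have hC : CondC K (φ w) (φ z) r ↔ ¬∃ m, m ^ 3 = delta₁ w z * algebraMap K M c := by
    rw [CondC, hrange, mem_fieldRange_iff_exists_pow_eq φ hw hr]
  have hD : CondD K (φ w) (φ z) s ↔ ¬∃ m, m ^ 2 = (delta₁ w z + 1) * algebraMap K M c := by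
    rw [CondD, hrange, mem_fieldRange_iff_exists_pow_eq φ hneg hs]
  rw [← stepDegree_congr hC, ← stepDegree_congr hD, ← hfin]
  refine finrank_divisionField_mordellCurve_seven hc hφw (hz.map_of_injective φ.injective) ?_ ?_
  · rw [hr, map_mul, hδ, AlgHom.commutes]
  · rw [hs, map_mul, map_add, hδ, map_one, AlgHom.commutes]

theorem exists_finrank_divisionField_eq (hw : IsPrimitiveRoot w 3)
    (hz : IsPrimitiveRoot z 7) (htop : adjoin K {w, z} = ⊤)
    (hwK : w ∈ Set.range (algebraMap K M)) :
    ∃ c : K, c ≠ 0 ∧ finrank K (divisionField (mordellCurve c) 7) = finrank K M := by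
  obtain ⟨c, hc, h3, h2⟩ := exists_pow_three_eq_and_sq_eq_of_mem_range hw hz hwK
  refine ⟨c, hc, ?_⟩
  rw [finrank_divisionField_mordellCurve_seven_of_adjoin_eq_top hw hz htop hc]
  simp only [stepDegree, h3, h2, not_true, if_false, mul_one]

theorem exists_finrank_divisionField_eq_mul_two (hw : IsPrimitiveRoot w 3)
    (hz : IsPrimitiveRoot z 7) (htop : adjoin K {w, z} = ⊤) {t : K}
    (ht : ∀ m : M, m ^ 2 ≠ algebraMap K M t) :
    ∃ c : K, c ≠ 0 ∧ finrank K (divisionField (mordellCurve c) 7) = finrank K M * 2 := by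
  have hM := neZero_two_of_algebra K M
  have h7 : (7 : K) ≠ 0 := fun h ↦ seven_ne_zero_of_primitiveRoot hz <| by
    rw [← map_ofNat (algebraMap K M), h, map_zero]
  have hc₀ : (2 ^ 4 / 7 : K) ≠ 0 := div_ne_zero (pow_ne_zero 4 two_ne_zero) h7
  have h3 : ∃ m, m ^ 3 = delta₁ w z * algebraMap K M (2 ^ 4 / 7) := by
    simpa only [map_div₀, map_pow, map_ofNat] using exists_pow_three_eq_delta₁_mul hw hz
  obtain ⟨c, hc, h2, hiff⟩ := exists_twist (k := 3) (by norm_num) (delta₁_add_one_ne_zero hw hz)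
    (delta₁ w z) hc₀ ht
  refine ⟨c, hc, ?_⟩
  rw [finrank_divisionField_mordellCurve_seven_of_adjoin_eq_top hw hz htop hc]
  simp only [stepDegree, hiff, h3, h2, not_true, not_false_eq_true, if_false, if_true, mul_one]

theorem exists_finrank_divisionField_eq_mul_three (hw : IsPrimitiveRoot w 3)
    (hz : IsPrimitiveRoot z 7) (htop : adjoin K {w, z} = ⊤)
    (hwK : w ∈ Set.range (algebraMap K M)) {t : K} (ht : ∀ m : M, m ^ 3 ≠ algebraMap K M t) :
    ∃ c : K, c ≠ 0 ∧ finrank K (divisionField (mordellCurve c) 7) = finrank K M * 3 := by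
  have hM := neZero_two_of_algebra K M
  obtain ⟨c₀, hc₀, -, h2⟩ := exists_pow_three_eq_and_sq_eq_of_mem_range hw hz hwK
  obtain ⟨c, hc, h3, hiff⟩ := exists_twist (k := 2) (by norm_num) (delta₁_ne_zero hw hz)
    (delta₁ w z + 1) hc₀ ht
  refine ⟨c, hc, ?_⟩
  rw [finrank_divisionField_mordellCurve_seven_of_adjoin_eq_top hw hz htop hc]
  simp only [stepDegree, hiff, h3, h2, not_true, not_false_eq_true, if_false, if_true, mul_one]

theorem exists_finrank_divisionField_eq_mul_six (hw : IsPrimitiveRoot w 3)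
    (hz : IsPrimitiveRoot z 7) (htop : adjoin K {w, z} = ⊤) {t : K}
    (ht₂ : ∀ m : M, m ^ 2 ≠ algebraMap K M t) (ht₃ : ∀ m : M, m ^ 3 ≠ algebraMap K M t) :
    ∃ c : K, c ≠ 0 ∧ finrank K (divisionField (mordellCurve c) 7) = finrank K M * 6 := by
  have hM := neZero_two_of_algebra K M
  obtain ⟨c₀, hc₀, h3, -⟩ := exists_twist (k := 2) (by norm_num) (delta₁_ne_zero hw hz)
    (delta₁ w z + 1) one_ne_zero ht₃
  obtain ⟨c, hc, h2, hiff⟩ := exists_twist (k := 3) (by norm_num) (delta₁_add_one_ne_zero hw hz)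
    (delta₁ w z) hc₀ ht₂
  refine ⟨c, hc, ?_⟩
  rw [finrank_divisionField_mordellCurve_seven_of_adjoin_eq_top hw hz htop hc]
  simp only [stepDegree, hiff, h3, h2, not_false_eq_true, if_true, mul_assoc, Nat.reduceMul]

end Twists

section Subfields

open Module NumberField

theorem exists_subgroup_natCard_eq_of_dvd {G : Type*} [Group G] [IsMulCommutative G] [Finite G]
    {n : ℕ} (hn : n ∣ Nat.card G) : ∃ H : Subgroup G, Nat.card H = n := by
  induction n using Nat.recOnPosPrimePosCoprime with
  | prime_pow p k hp _ =>
    have : Fact p.Prime := ⟨hp⟩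
    exact Sylow.exists_subgroup_card_pow_prime p hn
  | zero => exact absurd (zero_dvd_iff.mp hn) Nat.card_pos.ne'
  | one => exact ⟨⊥, Subgroup.card_bot⟩
  | coprime a b _ _ hab iha ihb =>
    obtain ⟨A, hA⟩ := iha (dvd_of_mul_right_dvd hn)
    obtain ⟨B, hB⟩ := ihb (dvd_of_mul_left_dvd hn)
    refine ⟨A ⊔ B, le_antisymm ?_ (Nat.le_of_dvd Nat.card_pos (hab.mul_dvd_of_dvd_of_dvd ?_ ?_))⟩
    · rw [← hA, ← hB]
      have := Set.natCard_mul_le (s := (A : Set G)) (t := (B : Set G))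
      rwa [← Subgroup.mul_normal] at this
    · exact hA ▸ Subgroup.card_dvd_of_le le_sup_left
    · exact hB ▸ Subgroup.card_dvd_of_le le_sup_right

theorem exists_intermediateField_finrank_eq {F E : Type*} [Field F] [Field E] [Algebra F E]
    [FiniteDimensional F E] [IsGalois F E] [IsMulCommutative Gal(E/F)] {n : ℕ}
    (hn : n ∣ finrank F E) : ∃ K : IntermediateField F E, finrank K E = n := by
  rw [← IsGalois.card_aut_eq_finrank] at hn
  obtain ⟨H, hH⟩ := exists_subgroup_natCard_eq_of_dvd hn
  exact ⟨fixedField H, by rw [finrank_fixedField_eq_card, hH]⟩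

theorem mem_range_algebraMap_of_odd_finrank {K M : Type*} [Field K] [Field M] [Algebra K M]
    (hodd : Odd (finrank K M)) {w : M} (hw : IsPrimitiveRoot w 3) :
    w ∈ Set.range (algebraMap K M) := by
  have hdeg := finrank_adjoin_insert_of_sq_eq (K := K) (S := ∅) (a := w) (p := -1) (q := -1)
    (neg_mem (one_mem _)) (neg_mem (one_mem _))
    (by linear_combination primitiveRoot_three_relation hw)
  rw [insert_empty_eq, adjoin_empty, IntermediateField.finrank_bot, one_mul] at hdeg
  have hdvd : finrank K K⟮w⟯ ∣ finrank K M := Dvd.intro _ (finrank_mul_finrank K K⟮w⟯ M)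
  by_contra hwK
  rw [hdeg, stepDegree, if_pos (by rwa [mem_bot])] at hdvd
  exact (Nat.not_even_iff_odd.mpr hodd) (even_iff_two_dvd.mpr hdvd)

theorem nonempty_ringOfIntegers_ringHom {n : ℕ} [NeZero n] {M : Type*} [Field M] [NumberField M]
    [IsCyclotomicExtension {n} ℚ M] {R : Type*} [CommRing R] [IsDomain R] {μ : R}
    (hμ : IsPrimitiveRoot μ n) : Nonempty (𝓞 M →+* R) := by
  have hζ := IsCyclotomicExtension.zeta_spec n ℚ M
  have hmin : minpoly ℤ hζ.toInteger = Polynomial.cyclotomic n ℤ :=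
    (RingOfIntegers.minpoly_coe _).symm.trans
      (Polynomial.cyclotomic_eq_minpoly hζ (NeZero.pos n)).symm
  refine ⟨(hζ.integralPowerBasis.lift μ ?_).toRingHom⟩
  rw [hζ.integralPowerBasis_gen, hmin, Polynomial.aeval_def, Polynomial.eval₂_eq_eval_map,
    Polynomial.map_cyclotomic]
  exact hμ.isRoot_cyclotomic (NeZero.pos n)

theorem pow_ne_intCast_of_forall_pow_ne {M R : Type*} [Field M] [CharZero M] [CommRing R]
    (f : 𝓞 M →+* R) {n : ℕ} (hn : 0 < n) {a : ℤ} (h : ∀ v : R, v ^ n ≠ a) (m : M) :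
    m ^ n ≠ a := by
  intro hm
  obtain ⟨x, rfl⟩ : ∃ x : 𝓞 M, algebraMap (𝓞 M) M x = m :=
    ⟨⟨m, IsIntegral.of_pow hn (hm ▸ isIntegral_algebraMap)⟩, rfl⟩
  have hpow : x ^ n = a := RingOfIntegers.coe_injective (by simpa using hm)
  exact h (f x) (by rw [← map_pow, hpow, map_intCast])

end Subfields

section CyclotomicTwentyOne

open Module NumberField

theorem isPrimitiveRoot_nine_zmod_fortyThree : IsPrimitiveRoot (9 : ZMod 43) 21 :=
  IsPrimitiveRoot.mk_of_lt 9 (by norm_num) (by decide) fun l _ _ ↦ by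
    interval_cases l <;> decide

theorem adjoin_pow_seven_pow_three_eq_top {F M : Type*} [Field F] [Field M] [Algebra F M] {ζ : M}
    (hζ : IsPrimitiveRoot ζ 21) (htop : F⟮ζ⟯ = ⊤) : adjoin F {ζ ^ 7, ζ ^ 3} = ⊤ := by
  have h7 : ζ ^ 7 ∈ adjoin F {ζ ^ 7, ζ ^ 3} := subset_adjoin F _ (by simp)
  have h3 : ζ ^ 3 ∈ adjoin F {ζ ^ 7, ζ ^ 3} := subset_adjoin F _ (by simp)
  have heq : ζ ^ 7 * (ζ ^ 3) ^ 5 = ζ := by linear_combination ζ * hζ.pow_eq_one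
  have hmem := mul_mem h7 (pow_mem h3 5)
  rw [heq] at hmem
  exact top_le_iff.mp (htop ▸ adjoin_simple_le_iff.mpr hmem)

variable (M : Type*) [Field M] [NumberField M] [IsCyclotomicExtension {21} ℚ M]

theorem finrank_cyclotomicExtension_twentyOne : finrank ℚ M = 12 := by
  rw [IsCyclotomicExtension.finrank (n := 21) M
    (Polynomial.cyclotomic.irreducible_rat (by norm_num))]
  decide

variable {M}

/-- The prime `43` splits completely in `ℚ(ζ₂₁)`, and `3` is neither a square nor a cube modulo
`43`. -/
theorem pow_ne_three_of_isCyclotomicExtension {n : ℕ} (hn : n = 2 ∨ n = 3) (m : M) :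
    m ^ n ≠ 3 := by
  have : Fact (Nat.Prime 43) := ⟨by norm_num⟩
  obtain ⟨f⟩ := nonempty_ringOfIntegers_ringHom (M := M) isPrimitiveRoot_nine_zmod_fortyThree
  refine mod_cast pow_ne_intCast_of_forall_pow_ne f (a := 3) (by omega) ?_ m
  rcases hn with rfl | rfl <;> decide

variable (M)

theorem exists_intermediateField_finrank_divisionField_eq_mul {n k : ℕ} (hn : n ∣ 12) (hk : k ∣ 6)
    (hnk : Odd n ∨ Even k) : ∃ (K : IntermediateField ℚ M) (c : K), c ≠ 0 ∧
      finrank K (divisionField (mordellCurve c) 7) = n * k := by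
  have hgal : IsGalois ℚ M := IsCyclotomicExtension.isGalois {21} ℚ M
  have hcomm : IsMulCommutative Gal(M/ℚ) := IsCyclotomicExtension.isMulCommutative {21} ℚ M
  rw [← finrank_cyclotomicExtension_twentyOne M] at hn
  obtain ⟨K, rfl⟩ := exists_intermediateField_finrank_eq hn
  have hζ := IsCyclotomicExtension.zeta_spec 21 ℚ M
  have hw := hζ.pow (by norm_num) (show 21 = 7 * 3 by norm_num)
  have hz := hζ.pow (by norm_num) (show 21 = 3 * 7 by norm_num)
  have htop := adjoin_pow_seven_pow_three_eq_top (F := K) hζ <|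
    adjoin_eq_top_of_adjoin_eq_top ℚ <| adjoin_eq_top_of_algebra ℚ _ <|
      IsCyclotomicExtension.adjoin_primitive_root_eq_top hζ
  have hpow {m : ℕ} (hm : m = 2 ∨ m = 3) (t : M) : t ^ m ≠ algebraMap K M 3 := by
    rw [map_ofNat]
    exact pow_ne_three_of_isCyclotomicExtension hm t
  refine ⟨K, ?_⟩
  have hk' : k ∈ Nat.divisors 6 := by simp [hk]
  rw [show Nat.divisors 6 = {1, 2, 3, 6} from rfl] at hk'
  simp only [Finset.mem_insert, Finset.mem_singleton] at hk'
  rcases hk' with rfl | rfl | rfl | rfl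
  · have hodd := hnk.resolve_right (by decide)
    rw [mul_one]
    exact exists_finrank_divisionField_eq hw hz htop (mem_range_algebraMap_of_odd_finrank hodd hw)
  · exact exists_finrank_divisionField_eq_mul_two hw hz htop (hpow (.inl rfl))
  · have hodd := hnk.resolve_right (by decide)
    exact exists_finrank_divisionField_eq_mul_three hw hz htop
      (mem_range_algebraMap_of_odd_finrank hodd hw) (hpow (.inr rfl))
  · exact exists_finrank_divisionField_eq_mul_six hw hz htop (hpow (.inl rfl)) (hpow (.inr rfl))

theorem exists_mul_eq_of_mem_possibleDegrees : ∀ d ∈ possibleDegrees,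
    ∃ n ∈ Nat.divisors 12, ∃ k ∈ Nat.divisors 6, (Odd n ∨ Even k) ∧ n * k = d := by
  decide

end CyclotomicTwentyOne

theorem theorem5_general :
    (∀ (K : Type*) [Field K] [NeZero (2 : K)] (c : K) (_ : c ≠ 0)
      (ζ₃ ζ₇ r s : AlgebraicClosure K)
      (_ : IsPrimitiveRoot ζ₃ 3) (_ : IsPrimitiveRoot ζ₇ 7)
      (_ : r ^ 3 = delta₁ ζ₃ ζ₇ * algebraMap K (AlgebraicClosure K) c)
      (_ : s ^ 2 = (delta₁ ζ₃ ζ₇ + 1) * algebraMap K (AlgebraicClosure K) c),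
      Module.finrank K (divisionField (mordellCurve c) 7) ∈ possibleDegrees ∧
      DegreeTable (CondA K ζ₃) (CondB1 K ζ₃ ζ₇) (CondB2 K ζ₃ ζ₇) (CondC K ζ₃ ζ₇ r)
        (CondD K ζ₃ ζ₇ s) (Module.finrank K (divisionField (mordellCurve c) 7))) ∧
    (∀ d ∈ possibleDegrees, ∃ (K : IntermediateField ℚ (CyclotomicField 21 ℚ)) (c : K),
      c ≠ 0 ∧ Module.finrank K (divisionField (mordellCurve c) 7) = d) := by
  refine ⟨fun K _ _ c hc ζ₃ ζ₇ r s hζ₃ hζ₇ hr hs ↦ ?_, fun d hd ↦ ?_⟩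
  · apply degreeTable_stepDegree
    rw [finrank_divisionField_mordellCurve_seven hc hζ₃ hζ₇ hr hs,
      finrank_adjoin_primitiveRoots hζ₃ hζ₇]
  · obtain ⟨n, hn, k, hk, hnk, rfl⟩ := exists_mul_eq_of_mem_possibleDegrees d hd
    have : IsCyclotomicExtension {21} ℚ (CyclotomicField 21 ℚ) :=
      CyclotomicField.isCyclotomicExtension 21 ℚ
    exact exists_intermediateField_finrank_divisionField_eq_mul _
      (Nat.dvd_of_mem_divisors hn) (Nat.dvd_of_mem_divisors hk) hnk

theorem theorem5 :
    (∀ (K : Type*) [Field K] [NumberField K] (c : K) (_ : c ≠ 0)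
      (ζ₃ ζ₇ r s : AlgebraicClosure K)
      (_ : IsPrimitiveRoot ζ₃ 3) (_ : IsPrimitiveRoot ζ₇ 7)
      (_ : r ^ 3 = delta₁ ζ₃ ζ₇ * algebraMap K (AlgebraicClosure K) c)
      (_ : s ^ 2 = (delta₁ ζ₃ ζ₇ + 1) * algebraMap K (AlgebraicClosure K) c),
      Module.finrank K (divisionField (mordellCurve c) 7) ∈ possibleDegrees ∧
      DegreeTable (CondA K ζ₃) (CondB1 K ζ₃ ζ₇) (CondB2 K ζ₃ ζ₇) (CondC K ζ₃ ζ₇ r)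
        (CondD K ζ₃ ζ₇ s) (Module.finrank K (divisionField (mordellCurve c) 7))) ∧
    (∀ d ∈ possibleDegrees, ∃ (K : Type) (_ : Field K) (_ : NumberField K) (c : K),
      c ≠ 0 ∧ Module.finrank K (divisionField (mordellCurve c) 7) = d) := by
  refine theorem5_general.imp (fun table K _ _ ↦ table K) fun attained d hd ↦ ?_
  obtain ⟨K, c, hK⟩ := attained d hd
  exact ⟨K, inferInstance, inferInstance, c, hK⟩
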